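/- All matroids are finite. A matroid is simple if it has no loops and no parallel pairs of elements; it is $\mathrm{GF}(p)$-representable if there is a matrix over the field $\mathrm{GF}(p)$ with $p$ elements whose columns are indexed by the elements of the matroid, such that a set of elements is independent exactly when the corresponding columns are linearly independent. A point of a matroid is a flat of rank $1$, and a flat $F$ is monochromatic in a colouring of the points if all points contained in $F$ have the same colour. For every prime $p$ and every integer $k\ge 1$ there is an integer $N$ such that, if $M$ is a simple $\mathrm{GF}(p)$-representable matroid of rank at least $N$, then for every $2$-colouring of the points of $M$ there is a monochromatic rank-$k$ flat of $M$. -/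

import Mathlib

namespace Matroid

/-- A matroid is simple if it has no loops and no pairs of parallel elements. The case `e = f`
says that `e` is not a loop, the case `e ≠ f` that `e` and `f` are not parallel. -/
def IsSimple {α : Type*} (M : Matroid α) : Prop :=
  ∀ ⦃e f : α⦄, e ∈ M.E → f ∈ M.E → M.Indep {e, f}

/-- `M` is representable over `𝔽`: there is a matrix over `𝔽`, with finitely many rows and with
columns `v e` indexed by the elements, such that the independent sets of `M` are exactly
the sets of elements whose columns are linearly independent (as a family, so that parallel
elements may have equal columns). -/
def IsRepresentableOver {α : Type*} (M : Matroid α) (𝔽 : Type*) [Field 𝔽] : Prop :=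
  ∃ (n : ℕ) (v : α → Fin n → 𝔽), ∀ I ⊆ M.E, M.Indep I ↔ LinearIndepOn 𝔽 v I

/-- `F` is a flat of `M` of rank `k`. -/
def IsFlatOfRank {α : Type*} (M : Matroid α) (k : ℕ) (F : Set α) : Prop :=
  M.IsFlat F ∧ M.eRk F = k

/-- A point of a matroid is a flat of rank one. -/
abbrev Point {α : Type*} (M : Matroid α) : Type _ :=
  {P : Set α // M.IsFlatOfRank 1 P}

/-- The set `F` is monochromatic in the colouring `c` of the points of `M`: all points of `M`
that are contained in `F` have the same colour. -/
def IsMonochromatic {α κ : Type*} (M : Matroid α) (c : M.Point → κ) (F : Set α) : Prop :=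
  ∃ i : κ, ∀ P : M.Point, P.1 ⊆ F → c P = i

end Matroid

/-! Colour each nonzero multiple of a represented element by the colour of its point, and all other
vectors `none`; let `S` be the set of coloured vectors together with 0. There are two cases. If some
`2k`-tuple in `S` has no combination in `S` with two nonzero coefficients, the tuple is independent
and its span meets `S` only in multiples of its members. By pigeonhole, `k` of them share a colour
and span the flat (`exists_independent_mono`). Otherwise `S` contains large affine subspaces
(`exists_affine_subset`): Hales-Jewett makes the coefficients of such combinations constant, and
Cauchy-Davenport enlarges the set of coefficients until it is all of `ZMod p`. By Hales-Jewett
again, some affine subspace `A` has a single colour `d`, and its direction space has a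
`k`-dimensional subspace `Z` of one colour, possibly `none` (`exists_mono_subspace`). If `Z` is
coloured, it suffices. If not, translate a basis of `Z` into `A`: every combination lies in `Z` or
is a multiple of a point of `A`, so only `d` occurs. -/

open Combinatorics

/-! ### Combinatorial subspaces as families of vectors -/

/-- The sum of the vectors in the coordinates of a combinatorial subspace labelled by the
parameter `e`. -/
noncomputable def Combinatorics.Subspace.direction {η α ι V : Type*} [Fintype ι] [AddCommMonoid V]
    (l : Subspace η α ι) (w : ι → V) (e : η) : V :=
  open Classical in ∑ t with l.idxFun t = Sum.inr e, w t

theorem Combinatorics.Subspace.sum_elim_smul {η α ι 𝔽 V : Type*} [Fintype ι] [Fintype η] [Ring 𝔽]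
    [AddCommGroup V] [Module 𝔽 V] (l : Subspace η α ι) (w : ι → V) (f : α → 𝔽) (g : η → 𝔽) :
    ∑ t, Sum.elim f g (l.idxFun t) • w t =
      ∑ t, Sum.elim f 0 (l.idxFun t) • w t + ∑ e, g e • l.direction w e := by
  classical
  simp only [Subspace.direction, Finset.smul_sum, Finset.sum_filter]
  rw [Finset.sum_comm, ← Finset.sum_add_distrib]
  refine Finset.sum_congr rfl fun t _ ↦ ?_
  rcases l.idxFun t with a | e <;> simp

/-- Letters need not be scalars: in `exists_cube` they are tuples, and `f` gives the coefficient
that a tuple contributes. -/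
theorem Combinatorics.Subspace.sum_apply_smul {η α ι 𝔽 V : Type*} [Fintype ι] [Fintype η] [Ring 𝔽]
    [AddCommGroup V] [Module 𝔽 V] (l : Subspace η α ι) (w : ι → V) (f : α → 𝔽) (z : η → α) :
    ∑ t, f (l z t) • w t =
      ∑ t, Sum.elim f 0 (l.idxFun t) • w t + ∑ e, f (z e) • l.direction w e := by
  rw [← l.sum_elim_smul w f (fun e ↦ f (z e))]
  refine Finset.sum_congr rfl fun t _ ↦ ?_
  rw [Subspace.apply_def]
  rcases l.idxFun t with a | e <;> simp

/-- Directions are sums over disjoint sets of coordinates, nonempty because the subspace is proper.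
-/
theorem Combinatorics.Subspace.linearIndependent_direction {η α ι 𝔽 V : Type*} [Fintype ι]
    [Fintype η] [Ring 𝔽] [AddCommGroup V] [Module 𝔽 V] (l : Subspace η α ι) {w : ι → V}
    (hw : LinearIndependent 𝔽 w) : LinearIndependent 𝔽 (l.direction w) := by
  rw [Fintype.linearIndependent_iff] at hw ⊢
  intro g hg e
  obtain ⟨t, ht⟩ := l.proper e
  have h := hw (fun t ↦ Sum.elim 0 g (l.idxFun t)) (by
    rw [l.sum_elim_smul w 0 g, hg, add_zero]
    refine Finset.sum_eq_zero fun t _ ↦ ?_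
    rcases l.idxFun t with a | e <;> simp) t
  simpa [ht] using h

theorem Combinatorics.Subspace.direction_mem_span {η α ι 𝔽 V : Type*} [Fintype ι] [Ring 𝔽]
    [AddCommGroup V] [Module 𝔽 V] (l : Subspace η α ι) (w : ι → V) (e : η) :
    l.direction w e ∈ Submodule.span 𝔽 (Set.range w) :=
  Submodule.sum_mem _ fun t _ ↦ Submodule.subset_span ⟨t, rfl⟩

theorem Combinatorics.Line.apply_apply_eq {η ρ ι : Type*} (l : Line (η → ρ) ι) (f : η → ρ) (t : ι)
    (j : η) : l f t j = l (fun _ ↦ f j) t j := by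
  rw [Line.coe_apply, Line.coe_apply]
  rcases l.idxFun t with _ | _ <;> rfl

/-! ### Cubes in sets with proper combinations -/

/-- Every `K`-tuple of elements of `S` has a linear combination in `S` with at least two nonzero
coefficients. -/
def HasProperCombinations (𝔽 : Type*) {V : Type*} [Field 𝔽] [AddCommGroup V] [Module 𝔽 V]
    (K : ℕ) (S : Set V) : Prop :=
  ∀ x : Fin K → V, (∀ i, x i ∈ S) → ∃ a : Fin K → 𝔽,
    (∃ i j, i ≠ j ∧ a i ≠ 0 ∧ a j ≠ 0) ∧ ∑ i, a i • x i ∈ S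

/-- This supplies two-letter cubes, which Cauchy-Davenport cannot produce from one letter. The index
type `ι` precedes `ρ` because the induction, which doubles `ι`, calls the previous case with a far
larger `ρ`. -/
theorem exists_transversal_cube (𝔽 : Type*) [Field 𝔽] [Finite 𝔽] (K s : ℕ) :
    ∃ (ι : Type) (_ : Fintype ι), s < Fintype.card ι ∧ ∀ (ρ : Type) [Finite ρ] [Nonempty ρ],
      ∃ n : ℕ, ∀ (V : Type) [AddCommGroup V] [Module 𝔽 V] (S : Set V),
        HasProperCombinations 𝔽 K S → ∀ e : Fin n → V, LinearIndependent 𝔽 e → (∀ i, e i ∈ S) →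
          ∃ (x : V) (w : ι × ρ → V), LinearIndependent 𝔽 w ∧
            ∀ g : ι → ρ, x + ∑ i, w (i, g i) ∈ S := by
  induction s with
  | zero =>
    refine ⟨Unit, inferInstance, by simp, fun ρ _ _ ↦ ?_⟩
    have := Fintype.ofFinite ρ
    refine ⟨Fintype.card ρ, fun V _ _ S _ e he heS ↦ ⟨0, fun q ↦ e (Fintype.equivFin ρ q.2),
      he.comp _ fun q r h ↦ ?_, fun g ↦ by simpa using heS _⟩⟩
    exact Prod.ext rfl ((Fintype.equivFin ρ).injective h)
  | succ s ih =>
    classical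
    obtain ⟨ι, _, hs, ih⟩ := ih
    refine ⟨Bool × ι, inferInstance, by simp; lia, fun ρ _ _ ↦ ?_⟩
    obtain ⟨κ, _, hκ⟩ := Line.exists_mono_in_high_dimension (Fin K × ι → ρ) (Fin K → 𝔽)
    have : Nonempty (Fin K × (κ → ρ)) ∨ K = 0 := by
      rcases K with _ | K
      · exact .inr rfl
      · exact .inl ⟨(0, fun _ ↦ Classical.arbitrary ρ)⟩
    rcases this with _ | rfl
    swap
    · refine ⟨0, fun V _ _ S hS e _ _ ↦ ?_⟩
      obtain ⟨a, ⟨i, -⟩, -⟩ := hS Fin.elim0 (fun i ↦ i.elim0)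
      exact i.elim0
    obtain ⟨n, hn⟩ := ih (Fin K × (κ → ρ))
    refine ⟨n, fun V _ _ S hS e he heS ↦ ?_⟩
    obtain ⟨x, w, hw, hwS⟩ := hn V S hS e he heS
    have key (y : κ → Fin K × ι → ρ) := hS (fun j ↦ x + ∑ i, w (i, (j, fun t ↦ y t (j, i))))
      fun j ↦ hwS fun i ↦ (j, fun t ↦ y t (j, i))
    choose a ha hay using key
    -- Words are coloured by their coefficient vectors, so one vector `c` serves the whole line.
    obtain ⟨l, c, hc⟩ := hκ a
    let d : ρ := Classical.arbitrary ρ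
    obtain ⟨j₀, j₁, hj, h₀, h₁⟩ := ha (l fun _ ↦ d)
    rw [hc] at h₀ h₁
    let J : Bool → Fin K := fun b ↦ cond b j₁ j₀
    have hJ : J.Injective := by
      intro b b' h
      cases b <;> cases b' <;> simp_all [J, eq_comm]
    have hcJ (b : Bool) : c (J b) ≠ 0 := by cases b <;> simpa [J]
    let u (j : Fin K) (i : ι) (r : ρ) : V := w (i, (j, fun t ↦ l (fun _ ↦ r) t (j, i)))
    refine ⟨(∑ j, c j) • x + ∑ j ∈ (Finset.univ.erase j₀).erase j₁, c j • ∑ i, u j i d,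
      fun q ↦ c (J q.1.1) • u (J q.1.1) q.1.2 q.2, ?_, fun g ↦ ?_⟩
    · have hinj : Function.Injective fun q : (Bool × ι) × ρ ↦
          ((q.1.2, (J q.1.1, fun t ↦ l (fun _ ↦ q.2) t (J q.1.1, q.1.2))) :
            ι × (Fin K × (κ → ρ))) := by
        rintro ⟨⟨b, i⟩, r⟩ ⟨⟨b', i'⟩, r'⟩ h
        simp only [Prod.mk.injEq] at h
        obtain ⟨rfl, hb, h⟩ := h
        obtain rfl := hJ hb
        obtain ⟨t, ht⟩ := l.proper
        have := congrFun h t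
        simp only [Line.coe_apply, ht, Option.getD_none] at this
        rw [this]
      exact (hw.comp _ hinj).units_smul fun q ↦ Units.mk0 _ (hcJ q.1.1)
    -- Tuple members `j₀` and `j₁` follow the two halves of `g`; the rest stay at `d` and go into
    -- the base point.
    · let f : Fin K × ι → ρ := fun q ↦
        if q.1 = j₀ then g (false, q.2) else if q.1 = j₁ then g (true, q.2) else d
      have h := hay (l f)
      rw [hc] at h
      convert h using 1
      have hu (j i) : w (i, (j, fun t ↦ l f t (j, i))) = u j i (f (j, i)) := by
        simp only [u]
        congr! 4 with t
        exact l.apply_apply_eq f t _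
      simp only [hu, smul_add, Finset.sum_add_distrib, ← Finset.sum_smul, add_assoc]
      congr 1
      rw [← Finset.add_sum_erase _ _ (Finset.mem_univ j₀),
        ← Finset.add_sum_erase (Finset.univ.erase j₀) _ (a := j₁) (by simp [hj.symm]),
        Fintype.sum_prod_type]
      simp only [Fintype.sum_bool, J, cond_true, cond_false, Finset.smul_sum]
      have e₀ : ∀ i, f (j₀, i) = g (false, i) := by simp [f]
      have e₁ : ∀ i, f (j₁, i) = g (true, i) := by simp [f, hj.symm]
      have e₂ : ∑ j ∈ (Finset.univ.erase j₀).erase j₁, ∑ i, c j • u j i (f (j, i)) =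
          ∑ j ∈ (Finset.univ.erase j₀).erase j₁, ∑ i, c j • u j i d := by
        refine Finset.sum_congr rfl fun j hj ↦ ?_
        simp only [Finset.mem_erase] at hj
        simp [f, hj.1, hj.2.1]
      simp only [e₀, e₁, e₂]
      abel

/-- Two nonzero coefficients give a sumset of two `s`-sets, of size at least `min p (2s - 1)`, which
is at least `s + 1` since `2 ≤ s < p`. -/
theorem exists_proper_letters {p : ℕ} [Fact p.Prime] {K s : ℕ} (hs : 2 ≤ s) (hsp : s < p)
    {β : Fin s → ZMod p} (hβ : β.Injective) {a : Fin K → ZMod p} {i j : Fin K} (hij : i ≠ j)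
    (hi : a i ≠ 0) (hj : a j ≠ 0) :
    ∃ y : Fin (s + 1) → Fin K → Fin s, Function.Injective fun r ↦ ∑ t, a t * β (y r t) := by
  classical
  have : NeZero s := ⟨by lia⟩
  let B (c : ZMod p) : Finset (ZMod p) := Finset.univ.image fun r ↦ c * β r
  have hB {c : ZMod p} (hc : c ≠ 0) : (B c).card = s :=
    (Finset.card_image_of_injective _ ((mul_right_injective₀ hc).comp hβ)).trans (Finset.card_fin s)
  have hcd := ZMod.cauchy_davenport (p := p) Fact.out (s := B (a i)) (t := B (a j))
    (Finset.card_pos.1 (by rw [hB hi]; lia)) (Finset.card_pos.1 (by rw [hB hj]; lia))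
  rw [hB hi, hB hj] at hcd
  obtain ⟨T, hT, hTc⟩ := Finset.exists_subset_card_eq (show s + 1 ≤ _ from le_trans (by
    simp only [le_inf_iff]; lia) hcd)
  have hmem (r : Fin (s + 1)) : ∃ m m' : Fin s,
      a i * β m + a j * β m' = ((Finset.equivFinOfCardEq hTc).symm r : ZMod p) := by
    have := hT ((Finset.equivFinOfCardEq hTc).symm r).2
    obtain ⟨u, hu, v, hv, huv⟩ := Finset.mem_add.1 this
    simp only [B, Finset.mem_image, Finset.mem_univ, true_and] at hu hv
    obtain ⟨m, rfl⟩ := hu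
    obtain ⟨m', rfl⟩ := hv
    exact ⟨m, m', huv⟩
  choose m m' hm using hmem
  -- Positions other than `i` and `j` hold a fixed letter and only translate the sums.
  refine ⟨fun r t ↦ if t = i then m r else if t = j then m' r else 0, fun r r' h ↦ ?_⟩
  have hsum (r) : ∑ t, a t * β (if t = i then m r else if t = j then m' r else 0) =
      ((Finset.equivFinOfCardEq hTc).symm r : ZMod p) +
        ∑ t ∈ (Finset.univ.erase i).erase j, a t * β 0 := by
    rw [← hm, ← Finset.add_sum_erase _ _ (Finset.mem_univ i),
      ← Finset.add_sum_erase (Finset.univ.erase i) _ (a := j) (by simp [hij.symm]), ← add_assoc]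
    simp only [if_true, hij.symm, if_false]
    congr 1
    refine Finset.sum_congr rfl fun t ht ↦ ?_
    simp only [Finset.mem_erase] at ht
    simp [ht.1, ht.2.1]
  simp only [hsum, add_left_inj] at h
  exact (Finset.equivFinOfCardEq hTc).symm.injective (Subtype.ext h)

/-- The induction adds one coefficient value at a time. The new values are those of `∑ j, c j * β (z
j)`, with `c` the constant coefficient vector on a Hales-Jewett subspace over the alphabet of
`K`-tuples. -/
theorem exists_cube (p : ℕ) [Fact p.Prime] (K s : ℕ) (hs : 2 ≤ s) (hsp : s ≤ p) (m : ℕ) :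
    ∃ n : ℕ, ∀ (V : Type) [AddCommGroup V] [Module (ZMod p) V] (S : Set V),
      HasProperCombinations (ZMod p) K S →
        ∀ e : Fin n → V, LinearIndependent (ZMod p) e → (∀ i, e i ∈ S) →
          ∃ (β : Fin s → ZMod p) (x : V) (w : Fin m → V), β.Injective ∧
            LinearIndependent (ZMod p) w ∧ ∀ g : Fin m → Fin s, x + ∑ i, β (g i) • w i ∈ S := by
  induction s, hs using Nat.le_induction generalizing m with
  | base =>
    obtain ⟨ι, _, hm, h⟩ := exists_transversal_cube (ZMod p) K m
    obtain ⟨n, hn⟩ := h Bool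
    refine ⟨n, fun V _ _ S hS e he heS ↦ ?_⟩
    obtain ⟨x, w, hw, hwS⟩ := hn V S hS e he heS
    obtain ⟨φ⟩ : Nonempty (Fin m ↪ ι) :=
      Function.Embedding.nonempty_of_card_le (by simpa using hm.le)
    refine ⟨fun i ↦ (i : ℕ), x + ∑ i, w (i, false),
      fun i ↦ w (φ i, true) - w (φ i, false), ?_, ?_, fun g ↦ ?_⟩
    · intro i j h
      have := (ZMod.natCast_eq_natCast_iff' _ _ _).1 h
      rw [Nat.mod_eq_of_lt (by lia), Nat.mod_eq_of_lt (by lia)] at this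
      exact Fin.ext this
    · rw [Fintype.linearIndependent_iff] at hw ⊢
      intro g hg i
      classical
      let G : ι × Bool → ZMod p := fun q ↦
        if h : ∃ i, φ i = q.1 then cond q.2 (g h.choose) (- g h.choose) else 0
      have hG (i b) : G (φ i, b) = cond b (g i) (- g i) := by
        have h : ∃ i', φ i' = φ i := ⟨i, rfl⟩
        have h' := φ.injective h.choose_spec
        simp only [G, dif_pos h, h']
      have := hw G (by
        rw [Fintype.sum_prod_type, ← hg, ← Finset.sum_subset
          (Finset.subset_univ (Finset.univ.map φ))]
        · simp [hG, sub_eq_add_neg]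
        · intro q _ hq
          have : ¬ ∃ i, φ i = q := by simpa using hq
          simp [G, this]) (φ i, true)
      simpa [hG] using this
    · classical
      convert hwS (fun q ↦ if ∃ i, φ i = q ∧ g i = 1 then true else false) using 1
      rw [add_assoc]
      congr 1
      have : ∑ q, (w (q, if ∃ i, φ i = q ∧ g i = 1 then true else false) - w (q, false)) =
          ∑ i, (((g i : ℕ) : ZMod p)) • (w (φ i, true) - w (φ i, false)) := by
        rw [← Finset.sum_subset (Finset.subset_univ (Finset.univ.map φ)), Finset.sum_map]
        · refine Finset.sum_congr rfl fun i _ ↦ ?_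
          simp only [φ.injective.eq_iff, exists_eq_left]
          have h2 := (g i).2
          obtain h | h : g i = 0 ∨ g i = 1 := by lia
          · simp [h]
          · simp [h]
        · intro q _ hq
          have : ∀ i, φ i ≠ q := by simpa using hq
          simp [this]
      rw [← this, Finset.sum_sub_distrib]
      abel
  | succ s hs ih =>
    obtain ⟨ι, _, hι⟩ := Subspace.exists_mono_in_high_dimension
      (Fin K → Fin s) (Fin K → ZMod p) (Fin m)
    obtain ⟨n, hn⟩ := ih (by lia) (Fintype.card ι)
    refine ⟨n, fun V _ _ S hS e he heS ↦ ?_⟩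
    obtain ⟨β, x, w', hβ, hw', hwS'⟩ := hn V S hS e he heS
    let w : ι → V := w' ∘ Fintype.equivFin ι
    have hw : LinearIndependent (ZMod p) w := hw'.comp _ (Fintype.equivFin ι).injective
    have hwS (g : ι → Fin s) : x + ∑ i, β (g i) • w i ∈ S := by
      convert hwS' (g ∘ (Fintype.equivFin ι).symm) using 2
      rw [← (Fintype.equivFin ι).sum_comp]
      simp [w]
    have key (y : ι → Fin K → Fin s) := hS (fun j ↦ x + ∑ t, β (y t j) • w t)
      fun j ↦ hwS fun t ↦ y t j
    choose a ha hay using key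
    obtain ⟨l, c, hc⟩ := hι a
    have : NeZero s := ⟨by lia⟩
    obtain ⟨i, j, hij, hi, hj⟩ := ha (l fun _ _ ↦ 0)
    rw [hc] at hi hj
    obtain ⟨y, hy⟩ := exists_proper_letters hs (by lia) hβ hij hi hj
    let f (z : Fin K → Fin s) : ZMod p := ∑ j, c j * β (z j)
    refine ⟨fun r ↦ f (y r), (∑ j, c j) • x + ∑ t, Sum.elim f 0 (l.idxFun t) • w t,
      l.direction w, hy, l.linearIndependent_direction hw, fun g ↦ ?_⟩
    have h := hay (l fun e ↦ y (g e))
    rw [hc] at h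
    convert h using 1
    rw [add_assoc, ← l.sum_apply_smul w f fun e ↦ y (g e)]
    simp only [f, smul_add, Finset.sum_add_distrib, Finset.smul_sum, smul_smul,
      Finset.sum_smul]
    rw [Finset.sum_comm]

/-! ### Monochromatic affine and linear subspaces -/

theorem exists_mono_affine (𝔽 κ : Type) [Field 𝔽] [Finite 𝔽] [Finite κ] (m : ℕ) :
    ∃ n : ℕ, ∀ (V : Type) [AddCommGroup V] [Module 𝔽 V] (w : Fin n → V),
      LinearIndependent 𝔽 w → ∀ (x : V) (C : V → κ), ∃ (y : V) (u : Fin m → V),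
        LinearIndependent 𝔽 u ∧ y ∈ Submodule.span 𝔽 (Set.range w) ∧
          (∀ i, u i ∈ Submodule.span 𝔽 (Set.range w)) ∧
            ∃ c, ∀ v ∈ Submodule.span 𝔽 (Set.range u), C (x + y + v) = c := by
  obtain ⟨ι, _, hι⟩ := Subspace.exists_mono_in_high_dimension 𝔽 κ (Fin m)
  refine ⟨Fintype.card ι, fun V _ _ w' hw' x C ↦ ?_⟩
  let w : ι → V := w' ∘ Fintype.equivFin ι
  have hw : LinearIndependent 𝔽 w := hw'.comp _ (Fintype.equivFin ι).injective
  have hr : Set.range w = Set.range w' := (Fintype.equivFin ι).surjective.range_comp w'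
  obtain ⟨l, c, hc⟩ := hι fun b ↦ C (x + ∑ t, b t • w t)
  refine ⟨∑ t, Sum.elim id 0 (l.idxFun t) • w t, l.direction w, l.linearIndependent_direction hw,
    ?_, fun i ↦ hr ▸ l.direction_mem_span w i, c, fun v hv ↦ ?_⟩
  · exact Submodule.sum_mem _ fun t _ ↦ Submodule.smul_mem _ _
      (Submodule.subset_span (hr ▸ Set.mem_range_self t))
  · obtain ⟨b, rfl⟩ := (Submodule.mem_span_range_iff_exists_fun 𝔽).1 hv
    have h := l.sum_apply_smul w id b
    simp only [id] at h
    rw [add_assoc]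
    simp only [← hc b, h]

/-- Each step makes an affine subspace through a new leading vector monochromatic, and continues
inside its direction space. -/
theorem exists_leading_mono (𝔽 κ : Type) [Field 𝔽] [Finite 𝔽] [Finite κ] (K : ℕ) :
    ∃ n : ℕ, ∀ (V : Type) [AddCommGroup V] [Module 𝔽 V] (w : Fin n → V),
      LinearIndependent 𝔽 w → ∀ C : V → κ, ∃ (x : Fin K → V) (c : Fin K → κ),
        LinearIndependent 𝔽 x ∧ (∀ i, x i ∈ Submodule.span 𝔽 (Set.range w)) ∧
          ∀ (i : Fin K) (b : Fin K → 𝔽), (∀ j < i, b j = 0) → b i = 1 →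
            C (∑ j, b j • x j) = c i := by
  induction K with
  | zero =>
    exact ⟨0, fun V _ _ w _ C ↦ ⟨Fin.elim0, Fin.elim0, linearIndependent_empty_type,
      fun i ↦ i.elim0, fun i ↦ i.elim0⟩⟩
  | succ K ih =>
    obtain ⟨m, hm⟩ := ih
    obtain ⟨n, hn⟩ := exists_mono_affine 𝔽 κ m
    refine ⟨n + 1, fun V _ _ w hw C ↦ ?_⟩
    obtain ⟨hwt, hw0⟩ := linearIndependent_finSucc.1 hw
    obtain ⟨y, u, hu, hy, huw, d, hd⟩ := hn V (Fin.tail w) hwt (w 0) C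
    obtain ⟨x, c, hx, hxu, hc⟩ := hm V u hu C
    have htail : Submodule.span 𝔽 (Set.range (Fin.tail w)) ≤ Submodule.span 𝔽 (Set.range w) :=
      Submodule.span_mono (by rintro _ ⟨i, rfl⟩; exact ⟨i.succ, rfl⟩)
    have huw' : Submodule.span 𝔽 (Set.range u) ≤ Submodule.span 𝔽 (Set.range (Fin.tail w)) :=
      Submodule.span_le.2 (by rintro _ ⟨i, rfl⟩; exact huw i)
    have hxu' : Submodule.span 𝔽 (Set.range x) ≤ Submodule.span 𝔽 (Set.range u) :=
      Submodule.span_le.2 (by rintro _ ⟨i, rfl⟩; exact hxu i)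
    refine ⟨Fin.cons (w 0 + y) x, Fin.cons d c, linearIndependent_finCons.2 ⟨hx, fun h ↦ hw0 ?_⟩,
      ?_, ?_⟩
    · simpa using Submodule.sub_mem _ (huw' (hxu' h)) hy
    · refine Fin.cases ?_ fun i ↦ ?_
      · exact Submodule.add_mem _ (Submodule.subset_span ⟨0, rfl⟩) (htail hy)
      · exact htail (huw' (hxu i))
    · refine Fin.cases (fun b _ hb ↦ ?_) fun i b hlt hb ↦ ?_
      · rw [Fin.sum_univ_succ, hb, one_smul]
        exact hd _ (hxu' (Submodule.sum_mem _ fun j _ ↦ Submodule.smul_mem _ _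
          (Submodule.subset_span ⟨j, rfl⟩)))
      · rw [Fin.sum_univ_succ, hlt 0 (Fin.succ_pos i), zero_smul, zero_add]
        exact hc i (fun j ↦ b j.succ) (fun j hj ↦ hlt _ (Fin.succ_lt_succ_iff.2 hj)) hb

/-- A finite colouring of the points of a projective geometry of large rank over a finite field has
a monochromatic subspace of rank `k`. -/
theorem exists_mono_subspace (𝔽 κ : Type) [Field 𝔽] [Finite 𝔽] [Finite κ] [Nonempty κ] (k : ℕ) :
    ∃ n : ℕ, ∀ (V : Type) [AddCommGroup V] [Module 𝔽 V] (w : Fin n → V),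
      LinearIndependent 𝔽 w → ∀ C : V → κ, (∀ (a : 𝔽) (v : V), a ≠ 0 → C (a • v) = C v) →
        ∃ x : Fin k → V, LinearIndependent 𝔽 x ∧
          (∀ i, x i ∈ Submodule.span 𝔽 (Set.range w)) ∧
            ∃ c, ∀ v ∈ Submodule.span 𝔽 (Set.range x), v ≠ 0 → C v = c := by
  classical
  have := Fintype.ofFinite κ
  obtain ⟨n, hn⟩ := exists_leading_mono 𝔽 κ (Fintype.card κ * k)
  refine ⟨n, fun V _ _ w hw C hC ↦ ?_⟩
  obtain ⟨x, c, hx, hxw, hc⟩ := hn V w hw C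
  obtain ⟨d, hd⟩ := Fintype.exists_le_card_fiber_of_mul_le_card c (n := k) (by simp)
  -- The embedding preserves order, so leading positions are unchanged when extending coefficients
  -- by zero.
  let φ := Finset.orderEmbOfCardLe _ hd
  have hφ (i) : c (φ i) = d := by simpa using Finset.orderEmbOfCardLe_mem _ hd i
  refine ⟨x ∘ φ, hx.comp _ φ.injective, fun i ↦ hxw _, d, fun v hv hv0 ↦ ?_⟩
  obtain ⟨b, rfl⟩ := (Submodule.mem_span_range_iff_exists_fun 𝔽).1 hv
  have hne : (Finset.univ.filter fun i ↦ b i ≠ 0).Nonempty := by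
    by_contra! h
    refine hv0 (Finset.sum_eq_zero fun i _ ↦ ?_)
    have : b i = 0 := by simpa using (Finset.filter_eq_empty_iff.1 h) (Finset.mem_univ i)
    rw [this, zero_smul]
  obtain ⟨i, hi, hmin⟩ := Finset.exists_min_image _ id hne
  have hi : b i ≠ 0 := by simpa using hi
  let g : Fin (Fintype.card κ * k) → 𝔽 := Function.extend φ (fun j ↦ (b i)⁻¹ * b j) 0
  have hg (j) : g (φ j) = (b i)⁻¹ * b j := φ.injective.extend_apply _ _ j
  have hg0 (j) (hj : ∀ i, φ i ≠ j) : g j = 0 := Function.extend_apply' _ _ _ (by simpa using hj)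
  rw [← hC (b i)⁻¹ _ (inv_ne_zero hi), ← hφ i, ← hc (φ i) g, Finset.smul_sum]
  · congr 1
    rw [← Finset.sum_subset (Finset.subset_univ (Finset.univ.map φ.toEmbedding)), Finset.sum_map]
    · simp [hg, smul_smul]
    · intro q _ hq
      rw [hg0 q (by simpa using hq), zero_smul]
  · intro j hj
    by_cases h : ∃ t, φ t = j
    · obtain ⟨t, rfl⟩ := h
      have hlt : t < i := φ.lt_iff_lt.1 hj
      have : b t = 0 := by
        by_contra h
        exact absurd (hmin t (by simpa using h)) (not_le.2 hlt)
      rw [hg, this, mul_zero]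
    · exact hg0 j (by simpa using h)
  · rw [hg, inv_mul_cancel₀ hi]

/-! ### The two cases for the coloured vectors -/

/-- If a homogeneous set of vectors has no `K`-tuple whose proper combinations all avoid it, then
it contains a large affine subspace. -/
theorem exists_affine_subset (p : ℕ) [Fact p.Prime] (K m : ℕ) :
    ∃ n : ℕ, ∀ (V : Type) [AddCommGroup V] [Module (ZMod p) V] (S : Set V),
      HasProperCombinations (ZMod p) K S →
        ∀ e : Fin n → V, LinearIndependent (ZMod p) e → (∀ i, e i ∈ S) →
          ∃ (x : V) (w : Fin m → V), LinearIndependent (ZMod p) w ∧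
            ∀ v ∈ Submodule.span (ZMod p) (Set.range w), x + v ∈ S := by
  obtain ⟨n, hn⟩ := exists_cube p K p (Fact.out : p.Prime).two_le le_rfl m
  refine ⟨n, fun V _ _ S hS e he heS ↦ ?_⟩
  obtain ⟨β, x, w, hβ, hw, hwS⟩ := hn V S hS e he heS
  refine ⟨x, w, hw, fun v hv ↦ ?_⟩
  have hsurj : β.Surjective := ((Fintype.bijective_iff_injective_and_card β).2 ⟨hβ, by simp⟩).2
  obtain ⟨b, rfl⟩ := (Submodule.mem_span_range_iff_exists_fun _).1 hv
  choose g hg using fun i ↦ hsurj (b i)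
  simpa [hg] using hwS g

theorem exists_independent_mono {𝔽 V : Type} [Field 𝔽] [AddCommGroup V] [Module 𝔽 V] {k : ℕ}
    (hk : 1 ≤ k) {C : V → Option (Fin 2)} (h0 : C 0 = none)
    (hC : ∀ (a : 𝔽) (v : V), a ≠ 0 → C (a • v) = C v)
    (h : ¬ HasProperCombinations 𝔽 (2 * k) {v | v = 0 ∨ C v ≠ none}) :
    ∃ y : Fin k → V, LinearIndependent 𝔽 y ∧ (∀ i, C (y i) ≠ none) ∧
      ∃ d : Fin 2, ∀ v ∈ Submodule.span 𝔽 (Set.range y), C v ≠ none → C v = some d := by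
  classical
  unfold HasProperCombinations at h
  push Not at h
  obtain ⟨x, hxS, hx⟩ := h
  have hne (i) : x i ≠ 0 := by
    intro hi
    -- If `x i = 0`, then `x i + x j = x j` would be a proper combination in the set.
    obtain ⟨j, hj⟩ : ∃ j, j ≠ i := Fintype.exists_ne_of_one_lt_card (by simp; lia) i
    refine hx (Pi.single i 1 + Pi.single j 1)
      ⟨i, j, hj.symm, by simp [hj.symm], by simp [hj]⟩ ?_
    simp only [Pi.add_apply, add_smul, Finset.sum_add_distrib]
    simpa [Pi.single_apply, hi] using hxS j
  have hsupp (a : Fin (2 * k) → 𝔽) (ha : ∑ i, a i • x i ∈ {v | v = 0 ∨ C v ≠ none}) (i)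
      (hi : a i ≠ 0) : ∑ j, a j • x j = a i • x i := by
    refine Finset.sum_eq_single i (fun j _ hj ↦ ?_) (by simp)
    by_contra h
    exact hx a ⟨i, j, hj.symm, hi, fun h' ↦ h (by simp [h'])⟩ ha
  have hli : LinearIndependent 𝔽 x := by
    rw [Fintype.linearIndependent_iff]
    intro a ha i
    by_contra hi
    have := hsupp a (.inl ha) i hi
    rw [ha] at this
    exact (smul_ne_zero hi (hne i)) this.symm
  have hCx (i) : C (x i) ≠ none := (hxS i).resolve_left (hne i)
  obtain ⟨d, hd⟩ := Fintype.exists_le_card_fiber_of_mul_le_card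
    (fun i ↦ (C (x i)).get (Option.isSome_iff_ne_none.2 (hCx i))) (n := k) (by simp)
  let φ := Finset.orderEmbOfCardLe _ hd
  have hφ (i) : C (x (φ i)) = some d := by
    have := Finset.orderEmbOfCardLe_mem _ hd i
    simp only [Finset.mem_filter, Finset.mem_univ, true_and] at this
    rw [← this]
    simp [φ]
  refine ⟨x ∘ φ, hli.comp _ φ.injective, fun i ↦ hCx _, d, fun v hv hv0 ↦ ?_⟩
  obtain ⟨b, rfl⟩ := (Submodule.mem_span_range_iff_exists_fun 𝔽).1 hv
  let g : Fin (2 * k) → 𝔽 := Function.extend φ b 0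
  have hg (j) : g (φ j) = b j := φ.injective.extend_apply _ _ j
  have hg0 (j) (hj : ∀ i, φ i ≠ j) : g j = 0 := Function.extend_apply' _ _ _ (by simpa using hj)
  have hsum : ∑ i, g i • x i = ∑ i, b i • (x ∘ φ) i := by
    rw [← Finset.sum_subset (Finset.subset_univ (Finset.univ.map φ.toEmbedding)), Finset.sum_map]
    · simp [hg]
    · intro q _ hq
      rw [hg0 q (by simpa using hq), zero_smul]
  obtain ⟨i, hi⟩ : ∃ i, b i ≠ 0 := by
    by_contra! h
    exact hv0 (by simp [h, h0])
  have := hsupp g (by rw [hsum]; exact .inr hv0) (φ i) (by rwa [hg])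
  rw [← hsum, this, hg, hC _ _ hi, hφ]

theorem exists_mono_span (p : ℕ) [Fact p.Prime] (k : ℕ) (hk : 1 ≤ k) :
    ∃ n : ℕ, ∀ (V : Type) [AddCommGroup V] [Module (ZMod p) V] (C : V → Option (Fin 2)),
      C 0 = none → (∀ (a : ZMod p) (v : V), a ≠ 0 → C (a • v) = C v) →
        ∀ e : Fin n → V, LinearIndependent (ZMod p) e → (∀ i, C (e i) ≠ none) →
          ∃ y : Fin k → V, LinearIndependent (ZMod p) y ∧ (∀ i, C (y i) ≠ none) ∧
            ∃ d : Fin 2, ∀ v ∈ Submodule.span (ZMod p) (Set.range y),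
              C v ≠ none → C v = some d := by
  obtain ⟨m₁, h₁⟩ := exists_mono_subspace (ZMod p) (Option (Fin 2)) k
  -- The extra direction ensures two distinct points even if `m₁ = 0`; at most one is zero, so the
  -- common colour is not `none`.
  obtain ⟨m₂, h₂⟩ := exists_mono_affine (ZMod p) (Option (Fin 2)) (m₁ + 1)
  obtain ⟨n, hn⟩ := exists_affine_subset p (2 * k) m₂
  refine ⟨n, fun V _ _ C h0 hC e he heC ↦ ?_⟩
  by_cases hS : HasProperCombinations (ZMod p) (2 * k) {v | v = 0 ∨ C v ≠ none}
  swap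
  · exact exists_independent_mono hk h0 hC hS
  obtain ⟨x, w, hw, hwS⟩ := hn V _ hS e he fun i ↦ .inr (heC i)
  obtain ⟨y, u, hu, hy, huw, c, hc⟩ := h₂ V w hw x C
  have huw' : Submodule.span (ZMod p) (Set.range u) ≤ Submodule.span (ZMod p) (Set.range w) :=
    Submodule.span_le.2 (by rintro _ ⟨i, rfl⟩; exact huw i)
  have hmem (v) (hv : v ∈ Submodule.span (ZMod p) (Set.range u)) :
      x + y + v = 0 ∨ C (x + y + v) ≠ none := by
    rw [add_assoc]
    exact hwS _ (Submodule.add_mem _ hy (huw' hv))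
  have hu0 : u 0 ∈ Submodule.span (ZMod p) (Set.range u) := Submodule.subset_span ⟨0, rfl⟩
  have hcn : c ≠ none := by
    rintro rfl
    have h₀ := (hmem 0 (Submodule.zero_mem _)).resolve_right (not_not.2 (hc 0 (Submodule.zero_mem _)))
    have h₁ := (hmem _ hu0).resolve_right (not_not.2 (hc _ hu0))
    rw [add_zero] at h₀
    rw [h₀, zero_add] at h₁
    exact hu.ne_zero 0 h₁
  obtain ⟨d, rfl⟩ := Option.ne_none_iff_exists'.1 hcn
  obtain ⟨z, hz, hzu, c, hcz⟩ := h₁ V (u ∘ Fin.castSucc) (hu.comp _ (Fin.castSucc_injective _)) C hC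
  have hzu' : Submodule.span (ZMod p) (Set.range z) ≤ Submodule.span (ZMod p) (Set.range u) :=
    Submodule.span_le.2 (by
      rintro _ ⟨i, rfl⟩
      exact Submodule.span_mono (Set.range_comp_subset_range _ _) (hzu i))
  rcases c with _ | c
  swap
  · refine ⟨z, hz, fun i ↦ ?_, c, fun v hv hv0 ↦ hcz v hv ?_⟩
    · simp [hcz _ (Submodule.subset_span ⟨i, rfl⟩) (hz.ne_zero i)]
    · rintro rfl
      exact hv0 h0
  -- Otherwise the affine subspace would contain 0, whose colour is `none`.
  have hxy : x + y ∉ Submodule.span (ZMod p) (Set.range u) := fun h ↦ by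
    have := hc _ (Submodule.neg_mem _ h)
    simp [h0] at this
  have hsum (b : Fin k → ZMod p) :
      ∑ i, b i • (x + y + z i) = (∑ i, b i) • (x + y) + ∑ i, b i • z i := by
    simp only [smul_add, Finset.sum_add_distrib, Finset.sum_smul]
  have hzmem (b : Fin k → ZMod p) : ∑ i, b i • z i ∈ Submodule.span (ZMod p) (Set.range z) :=
    (Submodule.mem_span_range_iff_exists_fun _).2 ⟨b, rfl⟩
  refine ⟨fun i ↦ x + y + z i, ?_, fun i ↦ ?_, d, fun v hv hv0 ↦ ?_⟩
  · rw [Fintype.linearIndependent_iff]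
    intro b hb
    rw [hsum] at hb
    have hb0 : ∑ i, b i = 0 := by
      by_contra h
      refine hxy ((Submodule.smul_mem_iff _ h).1 ?_)
      rw [eq_neg_of_add_eq_zero_left hb]
      exact Submodule.neg_mem _ (hzu' (hzmem b))
    rw [hb0, zero_smul, zero_add] at hb
    exact Fintype.linearIndependent_iff.1 hz b hb
  · simp [hc _ (hzu' (Submodule.subset_span ⟨i, rfl⟩))]
  · obtain ⟨b, rfl⟩ := (Submodule.mem_span_range_iff_exists_fun _).1 hv
    rw [hsum] at hv0 ⊢
    by_cases hb : ∑ i, b i = 0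
    · rw [hb, zero_smul, zero_add] at hv0
      refine absurd ?_ hv0
      by_cases hz0 : ∑ i, b i • z i = 0
      · rw [hz0, h0]
      · exact hcz _ (hzmem b) hz0
    · rw [← hC (∑ i, b i)⁻¹ _ (inv_ne_zero hb), smul_add, smul_smul, inv_mul_cancel₀ hb, one_smul]
      exact hc _ (Submodule.smul_mem _ _ (hzu' (hzmem b)))

/-! ### From vectors back to matroids -/

namespace Matroid

theorem IsSimple.isNonloop {α : Type*} {M : Matroid α} (hM : M.IsSimple) {e : α} (he : e ∈ M.E) :
    M.IsNonloop e := by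
  rw [← indep_singleton]
  simpa using hM he he

theorem IsSimple.isFlatOfRank_closure_singleton {α : Type*} {M : Matroid α} (hM : M.IsSimple)
    {e : α} (he : e ∈ M.E) : M.IsFlatOfRank 1 (M.closure {e}) :=
  ⟨M.isFlat_closure _, by rw [eRk_closure_eq, eRk_singleton_eq_one_iff.2 (hM.isNonloop he)]; rfl⟩

theorem Point.exists_eq_closure {α : Type*} {M : Matroid α} (P : M.Point) :
    ∃ e ∈ M.E, e ∈ P.1 ∧ P.1 = M.closure {e} := by
  obtain ⟨e, heP, -, hPe⟩ := (eRk_eq_one_iff P.2.1.subset_ground).1 (by simpa using P.2.2)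
  exact ⟨e, P.2.1.subset_ground heP, heP,
    hPe.antisymm ((M.closure_subset_closure (by simpa using heP)).trans P.2.1.closure.subset)⟩

variable {α 𝔽 W κ : Type*} [Field 𝔽] [AddCommGroup W] [Module 𝔽 W] {M : Matroid α} {v : α → W}

theorem IsSimple.eq_of_smul_eq_smul (hM : M.IsSimple)
    (hv : ∀ I ⊆ M.E, M.Indep I ↔ LinearIndepOn 𝔽 v I) {e f : α} (he : e ∈ M.E) (hf : f ∈ M.E)
    {a b : 𝔽} (ha : a ≠ 0) (h : a • v e = b • v f) : e = f := by
  by_contra hne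
  have hind := (hv {e, f} (Set.pair_subset he hf)).1 (hM he hf)
  have := (LinearIndepOn.pair_iff v hne).1 hind a (-b) (by rw [h, neg_smul, add_neg_cancel])
  exact ha this.1

open Classical in
/-- The colouring of vectors induced by a colouring of the points of a represented simple matroid:
vectors that are not a nonzero multiple of an element of the matroid receive the colour `none`. -/
noncomputable def IsSimple.vectorColouring (hM : M.IsSimple) (𝔽 : Type*) [Field 𝔽] [Module 𝔽 W]
    (v : α → W) (c : M.Point → κ) (u : W) : Option κ :=
  if h : ∃ e ∈ M.E, ∃ a : 𝔽, a ≠ 0 ∧ u = a • v e then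
    some (c ⟨M.closure {h.choose}, hM.isFlatOfRank_closure_singleton h.choose_spec.1⟩)
  else none

theorem IsSimple.vectorColouring_ne_none_iff (hM : M.IsSimple) (c : M.Point → κ) {u : W} :
    hM.vectorColouring 𝔽 v c u ≠ none ↔ ∃ e ∈ M.E, ∃ a : 𝔽, a ≠ 0 ∧ u = a • v e := by
  unfold vectorColouring
  split_ifs with h <;> simp [h]

/-- Simplicity makes the element chosen in the definition unique. -/
theorem IsSimple.vectorColouring_smul (hM : M.IsSimple)
    (hv : ∀ I ⊆ M.E, M.Indep I ↔ LinearIndepOn 𝔽 v I) (c : M.Point → κ) {e : α} (he : e ∈ M.E)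
    {a : 𝔽} (ha : a ≠ 0) :
    hM.vectorColouring 𝔽 v c (a • v e) =
      some (c ⟨M.closure {e}, hM.isFlatOfRank_closure_singleton he⟩) := by
  have h : ∃ f ∈ M.E, ∃ b : 𝔽, b ≠ 0 ∧ a • v e = b • v f := ⟨e, he, a, ha, rfl⟩
  obtain ⟨b, -, hb⟩ := h.choose_spec.2
  have hef : h.choose = e := (hM.eq_of_smul_eq_smul hv he h.choose_spec.1 ha hb).symm
  unfold vectorColouring
  rw [dif_pos h]
  congr 3
  rw [hef]

theorem IsSimple.vectorColouring_smul_eq (hM : M.IsSimple)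
    (hv : ∀ I ⊆ M.E, M.Indep I ↔ LinearIndepOn 𝔽 v I) (c : M.Point → κ) {a : 𝔽} (ha : a ≠ 0)
    (u : W) : hM.vectorColouring 𝔽 v c (a • u) = hM.vectorColouring 𝔽 v c u := by
  by_cases h : ∃ e ∈ M.E, ∃ b : 𝔽, b ≠ 0 ∧ u = b • v e
  · obtain ⟨e, he, b, hb, rfl⟩ := h
    rw [smul_smul, hM.vectorColouring_smul hv c he hb,
      hM.vectorColouring_smul hv c he (mul_ne_zero ha hb)]
  · rw [not_ne_iff.1 ((hM.vectorColouring_ne_none_iff (𝔽 := 𝔽) (v := v) c).not.2 h), ← not_ne_iff,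
      hM.vectorColouring_ne_none_iff]
    rintro ⟨e, he, b, hb, hu⟩
    exact h ⟨e, he, a⁻¹ * b, mul_ne_zero (inv_ne_zero ha) hb, by
      rw [mul_smul, ← hu, smul_smul, inv_mul_cancel₀ ha, one_smul]⟩

theorem IsSimple.vectorColouring_zero (hM : M.IsSimple)
    (hv : ∀ I ⊆ M.E, M.Indep I ↔ LinearIndepOn 𝔽 v I) (c : M.Point → κ) :
    hM.vectorColouring 𝔽 v c 0 = none := by
  rw [← not_ne_iff, hM.vectorColouring_ne_none_iff (𝔽 := 𝔽)]
  rintro ⟨e, he, a, ha, h⟩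
  have hind := (hv {e} (by simpa)).1 (hM.isNonloop he).indep
  exact smul_ne_zero ha (hind.ne_zero (Set.mem_singleton e)) h.symm

/-- Linearly independent elements of a represented simple matroid span a monochromatic flat if the
nonzero multiples of elements in their linear span all have the same colour. -/
theorem IsSimple.exists_isMonochromatic_isFlatOfRank (hM : M.IsSimple)
    (hv : ∀ I ⊆ M.E, M.Indep I ↔ LinearIndepOn 𝔽 v I) (c : M.Point → κ) {k : ℕ} {y : Fin k → W}
    (hy : LinearIndependent 𝔽 y) (hyc : ∀ i, hM.vectorColouring 𝔽 v c (y i) ≠ none) {d : κ}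
    (hd : ∀ u ∈ Submodule.span 𝔽 (Set.range y), hM.vectorColouring 𝔽 v c u ≠ none →
      hM.vectorColouring 𝔽 v c u = some d) :
    ∃ F : Set α, M.IsFlatOfRank k F ∧ M.IsMonochromatic c F := by
  simp only [hM.vectorColouring_ne_none_iff] at hyc
  choose f hfE a ha hya using hyc
  have hvy (i) : v (f i) = (a i)⁻¹ • y i := by
    rw [hya, smul_smul, inv_mul_cancel₀ (ha i), one_smul]
  have hvf : LinearIndependent 𝔽 (v ∘ f) := by
    convert hy.units_smul (fun i ↦ (Units.mk0 (a i) (ha i))⁻¹) using 1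
    ext1 i
    simp [hvy, Units.smul_def]
  have hfinj : f.Injective := fun i j h ↦ hvf.injective (congrArg v h)
  have hsub : Set.range f ⊆ M.E := by rintro _ ⟨i, rfl⟩; exact hfE i
  have hind : M.Indep (Set.range f) := by
    rw [hv _ hsub, linearIndepOn_range_iff hfinj]
    exact hvf
  refine ⟨M.closure (Set.range f), ⟨M.isFlat_closure _, ?_⟩, d, fun P hP ↦ ?_⟩
  · rw [eRk_closure_eq, hind.eRk_eq_encard, ← Set.image_univ, hfinj.encard_image]
    simp
  · obtain ⟨e, he, heP, hPe⟩ := P.exists_eq_closure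
    have hspan : v e ∈ Submodule.span 𝔽 (Set.range y) := by
      -- If `v e` were outside the span, adding `e` would preserve independence, so `e` could not
      -- lie in the closure.
      have hmem : v e ∈ Submodule.span 𝔽 (v '' Set.range f) := by
        by_contra hne
        have hnot : e ∉ Set.range f := fun h ↦ hne (Submodule.subset_span ⟨e, h, rfl⟩)
        refine hnot ((hind.mem_closure_iff'.1 (hP heP)).2 ?_)
        rw [hv _ (Set.insert_subset he hsub), linearIndepOn_insert hnot]
        exact ⟨(hv _ hsub).1 hind, hne⟩
      refine Submodule.span_le.2 ?_ hmem
      rintro _ ⟨_, ⟨i, rfl⟩, rfl⟩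
      rw [hvy]
      exact Submodule.smul_mem _ _ (Submodule.subset_span ⟨i, rfl⟩)
    have hcol := hM.vectorColouring_smul hv c he (one_ne_zero (α := 𝔽))
    rw [one_smul] at hcol
    have := hd _ hspan (by simp [hcol])
    rw [hcol, Option.some.injEq] at this
    rw [← this]
    exact congrArg c (Subtype.ext hPe)

end Matroid

theorem mainTheorem3 (p : ℕ) [Fact p.Prime] (k : ℕ) (hk : 1 ≤ k) :
    ∃ N : ℕ, ∀ (α : Type*) (M : Matroid α) [M.Finite],
      M.IsSimple → M.IsRepresentableOver (ZMod p) → (N : ℕ∞) ≤ M.eRank →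
      ∀ c : M.Point → Fin 2,
        ∃ F : Set α, M.IsFlatOfRank k F ∧ M.IsMonochromatic c F := by
  obtain ⟨N, hN⟩ := exists_mono_span p k hk
  refine ⟨N, fun α M _ hM ⟨n, v, hv⟩ hrank c ↦ ?_⟩
  obtain ⟨B, hB⟩ := M.exists_isBase
  obtain ⟨I, hIB, hI⟩ := Set.exists_subset_encard_eq (hrank.trans hB.encard_eq_eRank.ge)
  have hIind := hB.indep.subset hIB
  have hIfin : I.Finite := Set.finite_of_encard_eq_coe hI
  have := hIfin.fintype
  have hcard : Fintype.card I = N := by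
    rw [← Nat.cast_inj (R := ℕ∞), ← hI, Set.encard_eq_coe_toFinset_card, Set.toFinset_card]
  let φ : Fin N ≃ I := (Fintype.equivFinOfCardEq hcard).symm
  obtain ⟨y, hy, hyc, d, hd⟩ := hN (Fin n → ZMod p) (hM.vectorColouring (ZMod p) v c)
    (hM.vectorColouring_zero hv c) (fun a u ha ↦ hM.vectorColouring_smul_eq hv c ha u)
    (fun i ↦ v (φ i)) (((hv I hIind.subset_ground).1 hIind).comp φ φ.injective) fun i ↦ by
      rw [hM.vectorColouring_ne_none_iff]
      exact ⟨φ i, hIind.subset_ground (φ i).2, 1, one_ne_zero, (one_smul _ _).symm⟩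
  exact hM.exists_isMonochromatic_isFlatOfRank hv c hy hyc hd
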